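/- Let $d\ge 1$, let $\mathbb T^d=\mathbb R^d/\mathbb Z^d$, let $H$ be a smooth positive function on $\mathbb T^d$, and let $\mathrm{We},r,a\in\mathbb R$, $\mathrm D>0$. Put $\Omega=\{(X,Y)\in\mathbb T^d\times\mathbb R:\ Y>-H(X)\}$. For $j\ge 0$ let the vector fields $u_j$, scalars $p_j$ and tensor ($(d+1)\times(d+1)$-matrix) fields $\sigma_j$ be functions of $(x,y)\in\mathbb T^d\times[0,1]$, and let the vector fields $U_j$, scalars $P_j$ and tensor fields $\Sigma_j$ be functions of $(x,X,Y)$, $x\in\mathbb T^d$, $(X,Y)\in\overline\Omega$, all smooth up to the boundary, with $U_0=0$, $P_0=0$, $\Sigma_0=0$. (In the application these are the elementary solutions of the expansion $u=\sum\varepsilon^k(u_k+U_k)$, $p=\sum\varepsilon^k(p_k+P_{k+1})$, $\sigma=\sum\varepsilon^k(\sigma_k+\Sigma_k)$ of a diffusive Oldroyd flow in a rough channel; the equations they solve are not needed for the statement.) For functions of $(x,X,Y)$ let $\nabla,\mathbb D$ act in $(X,Y)$ and $\nabla_x,\mathbb D_x,\Delta_x$ in $x$ only, where $(\nabla u)_{mn}=\partial_nu^{(m)}$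 and $\mathbb D$, $\mathbb W$ are the symmetric and skew-symmetric parts of the gradient; let $g_a(\nabla u,\sigma)=\sigma\mathbb W(u)-\mathbb W(u)\sigma-a(\sigma\mathbb D(u)+\mathbb D(u)\sigma)$. Put $G_1=0$ and, for $k\ge 2$, $$\begin{aligned}G_k={}&2r\mathbb D(U_{k-1})+2r\mathbb D_x(U_{k-2})-\Sigma_{k-2}+2\mathrm D\,\nabla_x\cdot\nabla\Sigma_{k-1}+\mathrm D\,\Delta_x\Sigma_{k-2}\\&-\mathrm{We}\sum_{i=0}^{k-2}\Big(u_i\cdot(\nabla\Sigma_{k-1-i}+\nabla_x\Sigma_{k-2-i})+U_i\cdot(\nabla\sigma_{k-2-i}+\nabla\Sigma_{k-1-i}+\nabla_x\Sigma_{k-2-i})\\&\qquad+g_a(\nabla u_i,\Sigma_{k-2-i})+g_a(\nabla U_{i+1}+\nabla_xU_i,\ \sigma_{k-2-i}+\Sigma_{k-2-i})\Big),\end{aligned}$$ where $u_i,\sigma_i$ are evaluated at the slow point $(x,y)$, and, for $k\ge 1$, on $Y=-H(X)$, $$N_k=(\nabla H\cdot\nabla_x)\sigma_{k-1}|_{y=0}+(\nabla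 H\cdot\nabla_x)\Sigma_{k-1}+\sum_{p=1}^{k-1}\frac{(-1)^p}{p!}H^p\,\partial_y^{p}\big((\nabla H\cdot\nabla_x)\sigma_{k-1-p}+\partial_y\sigma_{k-1-p}\big)|_{y=0}.$$ Define $b_k$ for $k\ge 0$, at each slow point, by the compatibility condition of the Neumann problem $-\mathrm D\Delta\Sigma_{k+1}=G_{k+1}$ in $\Omega$, $\partial_N\Sigma_{k+1}=N_{k+1}-b_k$ on $\partial\Omega$ (with $\partial_N=-\nabla H\cdot\nabla_X-\partial_Y$), namely $$b_k=\int_{\mathbb T^d}N_{k+1}(X)\,dX-\mathrm D^{-1}\int_{\{(X,Y)\in\Omega:\,Y<0\}}G_{k+1}(X,Y)\,dX\,dY .$$ Proposition 7. For every $k\ge 0$, the coefficient $b_k$ depends only on $(u_j,p_j,\sigma_j)_{j<k}$ and $(U_j,P_j,\Sigma_j)_{j\le k}$: two families that agree for these indices (with the same $H,\mathrm{We},r,a,\mathrm D$) have the same $b_k$ at every slow point. More precisely, $G_{k+1}$ depends only on these fields; so does $N_{k+1}-(\nabla H\cdot\nabla_x)\sigma_k|_{y=0}$; and the remaining term $(\nabla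 H\cdot\nabla_x)\sigma_k|_{y=0}$ has zero $X$-average, $\int_{\mathbb T^d}(\nabla H\cdot\nabla_x)\sigma_k|_{y=0}\,dX=0$, for every $x$. -/

import Mathlib

open MeasureTheory Set Matrix
open scoped ContDiff

namespace RoughOldroyd

noncomputable section

/-- Horizontal variables `x` (slow) or `X` (fast). Functions on the torus `𝕋^d = ℝ^d / ℤ^d` are
functions on `ℝ^d` that are `1`-periodic in each coordinate. -/
abbrev Space (d : ℕ) := Fin d → ℝ

/-- Vectors of `ℝ^{d+1}`; the last component is the vertical one. -/
abbrev Vec (d : ℕ) := Fin (d + 1) → ℝ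

/-- Tensors, that is, `(d+1) × (d+1)` real matrices. -/
abbrev Tensor (d : ℕ) := Matrix (Fin (d + 1)) (Fin (d + 1)) ℝ

/-- A fundamental cell of the torus; `∫ X in cell d, φ X` is the integral of `φ` over `𝕋^d`. -/
def cell (d : ℕ) : Set (Space d) := Set.univ.pi fun _ => Set.Ico (0 : ℝ) 1

/-- `1`-periodicity in each coordinate of `ℝ^d`. -/
def TorusPeriodic {d : ℕ} {β : Type*} (f : Space d → β) : Prop :=
  ∀ (l : Fin d) (x : Space d), f (x + Pi.single l 1) = f x

/-- The roughness profile: a smooth, periodic and positive function. -/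
structure IsProfile {d : ℕ} (H : Space d → ℝ) : Prop where
  smooth : ContDiff ℝ ∞ H
  periodic : TorusPeriodic H
  pos : ∀ X, 0 < H X

/-! ### Fields -/

/-- A scalar function of `(x, y)` on the closure `𝕋^d × [0, 1]` of the smooth domain `ω₀`,
smooth up to the boundary. -/
structure IsMacroField {d : ℕ} (f : Space d → ℝ → ℝ) : Prop where
  smooth : ContDiffOn ℝ ∞ (fun q : Space d × ℝ => f q.1 q.2) (Set.univ ×ˢ Set.Icc (0 : ℝ) 1)
  periodic : TorusPeriodic f

/-- A scalar function of `(x, X, Y)`, where `x ∈ 𝕋^d` and `(X, Y)` is in the closure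
`{Y ≥ -H(X)}` of the boundary layer domain `Ω`, smooth up to the boundary. -/
structure IsMicroField {d : ℕ} (H : Space d → ℝ) (f : Space d → Space d → ℝ → ℝ) : Prop where
  smooth : ContDiffOn ℝ ∞ (fun q : Space d × Space d × ℝ => f q.1 q.2.1 q.2.2)
    {q | -H q.2.1 ≤ q.2.2}
  periodic_slow : TorusPeriodic f
  periodic_fast : ∀ x, TorusPeriodic (f x)

/-- The terms `(u_j, p_j, σ_j)` and `(U_j, P_j, Σ_j)` of the two-scale expansion
`u = ∑ ε^j (u_j + U_j)`, `p = ∑ ε^j (p_j + P_{j+1})`, `σ = ∑ ε^j (σ_j + Σ_j)`,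
with `Sg` standing for the sequence of the `Σ_j`.
The boundary layer terms start at order one. -/
structure Expansion (d : ℕ) (H : Space d → ℝ) where
  u : ℕ → Space d → ℝ → Vec d
  p : ℕ → Space d → ℝ → ℝ
  σ : ℕ → Space d → ℝ → Tensor d
  U : ℕ → Space d → Space d → ℝ → Vec d
  P : ℕ → Space d → Space d → ℝ → ℝ
  Sg : ℕ → Space d → Space d → ℝ → Tensor d
  u_field : ∀ j m, IsMacroField fun x y => u j x y m
  p_field : ∀ j, IsMacroField (p j)
  σ_field : ∀ j m n, IsMacroField fun x y => σ j x y m n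
  U_field : ∀ j m, IsMicroField H fun x X Y => U j x X Y m
  P_field : ∀ j, IsMicroField H (P j)
  Sg_field : ∀ j m n, IsMicroField H fun x X Y => Sg j x X Y m n
  U_zero : U 0 = 0
  P_zero : P 0 = 0
  Sg_zero : Sg 0 = 0

/-! ### Differential operators -/

/-- The partial derivative `∂_l` of a function on `ℝ^d`. -/
def pd {d : ℕ} (l : Fin d) (f : Space d → ℝ) (x : Space d) : ℝ :=
  lineDeriv ℝ f x (Pi.single l 1)

/-- `∇f` for a function of `(x, y)`; the `y`-derivative is one-sided at `y = 0` and `y = 1`. -/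
def gradMacro {d : ℕ} (f : Space d → ℝ → ℝ) (x : Space d) (y : ℝ) : Vec d :=
  Fin.snoc (α := fun _ => ℝ) (fun l => pd l (fun x' => f x' y) x)
    (derivWithin (fun y' => f x y') (Set.Icc (0 : ℝ) 1) y)

/-- `∇f`, the gradient in the fast variables `(X, Y)` of a function of `(x, X, Y)`. -/
def gradFast {d : ℕ} (f : Space d → Space d → ℝ → ℝ) (x X : Space d) (Y : ℝ) : Vec d :=
  Fin.snoc (α := fun _ => ℝ) (fun l => pd l (fun X' => f x X' Y) X) (deriv (fun Y' => f x X Y') Y)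

/-- `∇_x f`, the gradient in the slow variable `x` of a function of `(x, X, Y)`, with a zero
vertical component. -/
def gradSlow {d : ℕ} (f : Space d → Space d → ℝ → ℝ) (x X : Space d) (Y : ℝ) : Vec d :=
  Fin.snoc (α := fun _ => ℝ) (fun l => pd l (fun x' => f x' X Y) x) 0

/-- `(∇u)_{mn} = ∂_n u^{(m)}` for a vector field of `(x, y)`. -/
def jacMacro {d : ℕ} (u : Space d → ℝ → Vec d) (x : Space d) (y : ℝ) : Tensor d :=
  Matrix.of fun m n => gradMacro (fun x' y' => u x' y' m) x y n

/-- `(∇U)_{mn} = ∂_n U^{(m)}`, derivatives in `(X, Y)`. -/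
def jacFast {d : ℕ} (U : Space d → Space d → ℝ → Vec d) (x X : Space d) (Y : ℝ) : Tensor d :=
  Matrix.of fun m n => gradFast (fun x' X' Y' => U x' X' Y' m) x X Y n

/-- `∇_x U`, derivatives in `x`. -/
def jacSlow {d : ℕ} (U : Space d → Space d → ℝ → Vec d) (x X : Space d) (Y : ℝ) : Tensor d :=
  Matrix.of fun m n => gradSlow (fun x' X' Y' => U x' X' Y' m) x X Y n

/-- `v · ∇σ`, for a tensor field of `(x, y)`. -/
def advMacro {d : ℕ} (v : Vec d) (σ : Space d → ℝ → Tensor d) (x : Space d) (y : ℝ) : Tensor d :=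
  Matrix.of fun m n => v ⬝ᵥ gradMacro (fun x' y' => σ x' y' m n) x y

/-- `v · ∇Σ`, derivatives in `(X, Y)`. -/
def advFast {d : ℕ} (v : Vec d) (S : Space d → Space d → ℝ → Tensor d) (x X : Space d) (Y : ℝ) :
    Tensor d :=
  Matrix.of fun m n => v ⬝ᵥ gradFast (fun x' X' Y' => S x' X' Y' m n) x X Y

/-- `v · ∇_x Σ`, derivatives in `x`. -/
def advSlow {d : ℕ} (v : Vec d) (S : Space d → Space d → ℝ → Tensor d) (x X : Space d) (Y : ℝ) :
    Tensor d :=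
  Matrix.of fun m n => v ⬝ᵥ gradSlow (fun x' X' Y' => S x' X' Y' m n) x X Y

/-- `∇_x · ∇Σ = ∑_l ∂_{x_l} ∂_{X_l} Σ`. -/
def mixedLaplacian {d : ℕ} (S : Space d → Space d → ℝ → Tensor d) (x X : Space d) (Y : ℝ) :
    Tensor d :=
  Matrix.of fun m n => ∑ l : Fin d, pd l (fun x' => pd l (fun X' => S x' X' Y m n) X) x

/-- `Δ_x Σ = ∑_l ∂_{x_l}^2 Σ`. -/
def slowLaplacian {d : ℕ} (S : Space d → Space d → ℝ → Tensor d) (x X : Space d) (Y : ℝ) :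
    Tensor d :=
  Matrix.of fun m n => ∑ l : Fin d, pd l (pd l (fun x' => S x' X Y m n)) x

/-- Symmetric part of a velocity gradient. -/
def symPart {d : ℕ} (M : Tensor d) : Tensor d := (1 / 2 : ℝ) • (M + Mᵀ)

/-- Skew-symmetric part of a velocity gradient. -/
def skewPart {d : ℕ} (M : Tensor d) : Tensor d := (1 / 2 : ℝ) • (M - Mᵀ)

/-- `g_a(∇u, σ) = σ·𝕎(u) - 𝕎(u)·σ - a (σ·𝔻(u) + 𝔻(u)·σ)`, as a function of `M = ∇u` and `σ`. -/
def gOp {d : ℕ} (a : ℝ) (M s : Tensor d) : Tensor d :=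
  s * skewPart M - skewPart M * s - a • (s * symPart M + symPart M * s)

/-! ### The boundary layer stress problems -/

/-- The source term `G_k` of `-D ΔΣ_k = G_k`, at the slow point `(x, y)` (where the `u_j`, `σ_j`
are evaluated) and at the fast point `(X, Y)`. Here `G_1 = 0`, and `G_{k+2}` is
`2r𝔻(U_{k+1}) + 2r𝔻_x(U_k) - Σ_k + 2D ∇_x·∇Σ_{k+1} + D Δ_xΣ_k - We ∑_{i=0}^{k} (…)`. -/
def G {d : ℕ} {H : Space d → ℝ} (We r a D : ℝ) (E : Expansion d H) :
    ℕ → Space d → ℝ → Space d → ℝ → Tensor d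
  | 0, _, _, _, _ => 0
  | 1, _, _, _, _ => 0
  | k + 2, x, y, X, Y =>
      (2 * r) • symPart (jacFast (E.U (k + 1)) x X Y)
      + (2 * r) • symPart (jacSlow (E.U k) x X Y)
      - E.Sg k x X Y
      + (2 * D) • mixedLaplacian (E.Sg (k + 1)) x X Y
      + D • slowLaplacian (E.Sg k) x X Y
      - We • ∑ i ∈ Finset.range (k + 1),
          (advFast (E.u i x y) (E.Sg (k + 1 - i)) x X Y
            + advSlow (E.u i x y) (E.Sg (k - i)) x X Y
            + (advMacro (E.U i x X Y) (E.σ (k - i)) x y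
              + advFast (E.U i x X Y) (E.Sg (k + 1 - i)) x X Y
              + advSlow (E.U i x X Y) (E.Sg (k - i)) x X Y)
            + gOp a (jacMacro (E.u i) x y) (E.Sg (k - i) x X Y)
            + gOp a (jacFast (E.U (i + 1)) x X Y + jacSlow (E.U i) x X Y)
                (E.σ (k - i) x y + E.Sg (k - i) x X Y))

/-- `(∇H(X) · ∇_x) σ` at the point `(x, y)`, for a tensor field of `(x, y)`. -/
def gradHMacro {d : ℕ} (H : Space d → ℝ) (σ : Space d → ℝ → Tensor d) (x : Space d) (y : ℝ)
    (X : Space d) : Tensor d :=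
  Matrix.of fun m n => ∑ l : Fin d, pd l H X * pd l (fun x' => σ x' y m n) x

/-- `(∇H · ∇_x) Σ` at the point `(X, -H(X))` of the boundary `Γ`. -/
def gradHBdry {d : ℕ} (H : Space d → ℝ) (S : Space d → Space d → ℝ → Tensor d) (x X : Space d) :
    Tensor d :=
  Matrix.of fun m n => ∑ l : Fin d, pd l H X * pd l (fun x' => S x' X (-H X) m n) x

/-- `∂_y^p ((∇H(X) · ∇_x) σ + ∂_y σ)` at `y = 0`. -/
def taylorTerm {d : ℕ} (H : Space d → ℝ) (q : ℕ) (σ : Space d → ℝ → Tensor d) (x X : Space d) :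
    Tensor d :=
  Matrix.of fun m n => iteratedDerivWithin q
    (fun y => gradHMacro H σ x y X m n
      + derivWithin (fun y' => σ x y' m n) (Set.Icc (0 : ℝ) 1) y)
    (Set.Icc (0 : ℝ) 1) 0

/-- The boundary term `N_k` of `∂_N Σ_k = N_k - b_{k-1}` on `Γ`, as a function of `X`:
`N_{k+1} = (∇H·∇_x)σ_k|_{y=0} + (∇H·∇_x)Σ_k
  + ∑_{p=1}^{k} ((-1)^p / p!) H^p ∂_y^p ((∇H·∇_x)σ_{k-p} + ∂_y σ_{k-p})|_{y=0}`. -/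
def N {d : ℕ} {H : Space d → ℝ} (E : Expansion d H) :
    ℕ → Space d → Space d → Tensor d
  | 0, _, _ => 0
  | k + 1, x, X =>
      gradHMacro H (E.σ k) x 0 X
      + gradHBdry H (E.Sg k) x X
      + ∑ q ∈ Finset.Icc 1 k,
          ((-1 : ℝ) ^ q / (Nat.factorial q : ℝ) * H X ^ q) • taylorTerm H q (E.σ (k - q)) x X

/-- The part `{Y < 0}` of one period of the boundary layer domain. -/
def roughCell {d : ℕ} (H : Space d → ℝ) : Set (Space d × ℝ) :=
  {q | q.1 ∈ cell d ∧ -H q.1 < q.2 ∧ q.2 < 0}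

/-- The coefficient `b_k` fixed by the compatibility condition of the Neumann problem for
`Σ_{k+1}`: `b_k = ∫_{𝕋^d} N_{k+1} dX - D⁻¹ ∫_{Y<0} G_{k+1} dX dY`, entry by entry, at the slow
point `(x, y)`. -/
def b {d : ℕ} {H : Space d → ℝ} (We r a D : ℝ) (E : Expansion d H) (k : ℕ)
    (x : Space d) (y : ℝ) : Tensor d :=
  Matrix.of fun m n =>
    (∫ X in cell d, N E (k + 1) x X m n)
      - D⁻¹ * ∫ q in roughCell H, G We r a D E (k + 1) x y q.1 q.2 m n

/-- `(u_j, p_j, σ_j)` is the same in both expansions, on the closure of `ω₀`. -/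
def SameMacro {d : ℕ} {H : Space d → ℝ} (E E' : Expansion d H) (j : ℕ) : Prop :=
  ∀ x, ∀ y ∈ Set.Icc (0 : ℝ) 1,
    E.u j x y = E'.u j x y ∧ E.p j x y = E'.p j x y ∧ E.σ j x y = E'.σ j x y

/-- `(U_j, P_j, Σ_j)` is the same in both expansions, on the closure of `Ω`. -/
def SameMicro {d : ℕ} {H : Space d → ℝ} (E E' : Expansion d H) (j : ℕ) : Prop :=
  ∀ x X Y, -H X ≤ Y →
    E.U j x X Y = E'.U j x X Y ∧ E.P j x X Y = E'.P j x X Y ∧ E.Sg j x X Y = E'.Sg j x X Y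

end

end RoughOldroyd

namespace RoughOldroyd

variable {d : ℕ} {H : Space d → ℝ}

/-! ### Periodic functions on the torus -/

/-! The proof is index counting plus one cancellation. In `G` at order `k + 1` the slow fields occur
up to index `k - 1` and the boundary layer fields up to index `k`. In `N` at order `k + 1` the only
slow field of index `k` is `σ k`, and it enters through `gradHMacro` alone. There `∂_{x_l} σ k` does
not depend on `X`, so the average over the cell reduces to that of `∂_l H`, which vanishes by
periodicity (`integral_cell_pd`).

Two analytic points remain. The fields are total functions that agree only on closed domains, so
each operator must be shown not to look outside: the `*_congr` lemmas. Splitting the integral of `N`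
requires integrability, obtained from continuity in `X` (`integrableOn_N`). -/

theorem cell_ae_eq_Icc : cell d =ᵐ[volume] Set.Icc (0 : Space d) 1 :=
  Measure.univ_pi_Ico_ae_eq_Icc (f := (0 : Space d)) (g := 1)

theorem measurableSet_cell : MeasurableSet (cell d) :=
  MeasurableSet.univ_pi fun _ => measurableSet_Ico

theorem pd_eq_fderiv {f : Space d → ℝ} (hf : ContDiff ℝ ∞ f) (l : Fin d) (X : Space d) :
    pd l f X = fderiv ℝ f X (Pi.single l 1) :=
  (hf.differentiable (by simp) X).lineDeriv_eq_fderiv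

theorem continuous_pd {f : Space d → ℝ} (hf : ContDiff ℝ ∞ f) (l : Fin d) :
    Continuous (pd l f) := by
  have h : pd l f = fun X => fderiv ℝ f X (Pi.single l 1) := funext (pd_eq_fderiv hf l)
  rw [h]
  exact (hf.continuous_fderiv (by simp)).clm_apply continuous_const

theorem _root_.Continuous.integrableOn_cell {f : Space d → ℝ} (hf : Continuous f) :
    IntegrableOn f (cell d) :=
  (hf.continuousOn.integrableOn_compact (isCompact_Icc (a := (0 : Space d)) (b := 1))).congr_set_ae
    cell_ae_eq_Icc

/-- A partial derivative of a smooth periodic function has zero mean. -/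
theorem integral_cell_pd {f : Space d → ℝ} (hf : ContDiff ℝ ∞ f) (hper : TorusPeriodic f)
    (l : Fin d) : ∫ X in cell d, pd l f X = 0 := by
  obtain _ | n := d
  · exact l.elim0
  rw [setIntegral_congr_set cell_ae_eq_Icc]
  have hsum : ∀ X, ∑ i, (if i = l then fderiv ℝ f X else 0) (Pi.single i 1) = pd l f X := by
    intro X
    rw [Finset.sum_eq_single l (by intro i _ hi; simp [hi]) (by simp), if_pos rfl,
      pd_eq_fderiv hf]
  -- Divergence theorem on the unit box for the field `f e_l`, whose divergence is `∂_l f`.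
  have key := integral_divergence_of_hasFDerivAt_off_countable' (0 : Space (n + 1)) 1
    zero_le_one (fun i => if i = l then f else 0)
    (fun i X => if i = l then fderiv ℝ f X else 0) ∅ Set.countable_empty
    (fun i => by
      split_ifs
      · exact hf.continuous.continuousOn
      · exact continuousOn_const)
    (fun X _ i => by
      split_ifs
      · exact (hf.differentiable (by simp) X).hasFDerivAt
      · exact hasFDerivAt_const (0 : ℝ) X)
    (by
      simp only [hsum]
      exact (continuous_pd hf l).continuousOn.integrableOn_compact isCompact_Icc)
  simp only [hsum] at key
  rw [key]
  refine Finset.sum_eq_zero fun i _ => ?_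
  rw [sub_eq_zero]
  refine integral_congr_ae (Filter.Eventually.of_forall fun Z => ?_)
  dsimp only
  split_ifs with hi
  · subst hi
    -- The face at `1` is the face at `0` translated by `e_i`, so the two fluxes cancel.
    rw [← hper i (i.insertNth ((0 : Space (n + 1)) i) Z)]
    congr 1
    ext j
    refine Fin.succAboveCases i ?_ (fun j => ?_) j <;> simp
  · rfl

theorem integrableOn_gradHMacro (hH : ContDiff ℝ ∞ H) (s : Space d → ℝ → Tensor d)
    (x : Space d) (y : ℝ) (m n : Fin (d + 1)) :
    IntegrableOn (fun X => gradHMacro H s x y X m n) (cell d) := by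
  refine Continuous.integrableOn_cell ?_
  simp only [gradHMacro, Matrix.of_apply]
  exact continuous_finsetSum (f := fun l X => pd l H X * pd l (fun x' => s x' y m n) x) _
    fun l _ => (continuous_pd hH l).mul continuous_const

theorem integral_gradHMacro (hH : IsProfile H) (s : Space d → ℝ → Tensor d)
    (x : Space d) (y : ℝ) (m n : Fin (d + 1)) :
    ∫ X in cell d, gradHMacro H s x y X m n = 0 := by
  simp only [gradHMacro, Matrix.of_apply]
  have hint : ∀ l ∈ Finset.univ,
      IntegrableOn (fun X => pd l H X * pd l (fun x' => s x' y m n) x) (cell d) :=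
    fun l _ => ((continuous_pd hH.smooth l).mul continuous_const).integrableOn_cell
  rw [integral_finsetSum _ hint]
  refine Finset.sum_eq_zero fun l _ => ?_
  rw [integral_mul_const, integral_cell_pd hH.smooth hH.periodic, zero_mul]

/-! ### Regularity of the boundary term -/

/-- Horizontal lines stay in the slab even at `y = 0` and `y = 1`, so the two-sided `pd` is the
derivative within the slab applied to `(e_l, 0)`, which is smooth up to the boundary. -/
theorem IsMacroField.contDiffOn_pd {f : Space d → ℝ → ℝ} (hf : IsMacroField f) (l : Fin d)
    (x : Space d) :
    ContDiffOn ℝ ∞ (fun y => pd l (fun x' => f x' y) x) (Set.Icc (0 : ℝ) 1) := by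
  set S : Set (Space d × ℝ) := Set.univ ×ˢ Set.Icc (0 : ℝ) 1
  set F : Space d × ℝ → ℝ := fun q => f q.1 q.2
  have hS : UniqueDiffOn ℝ S := uniqueDiffOn_univ.prod (uniqueDiffOn_Icc zero_lt_one)
  have hmaps : Set.MapsTo (fun y : ℝ => (x, y)) (Set.Icc (0 : ℝ) 1) S :=
    fun y hy => ⟨Set.mem_univ _, hy⟩
  have hd : ContDiffOn ℝ ∞ (fun q => fderivWithin ℝ F S q (Pi.single l 1, 0)) S :=
    (hf.smooth.fderivWithin hS (by simp)).clm_apply contDiffOn_const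
  refine (hd.comp (contDiff_const.prodMk contDiff_id).contDiffOn hmaps).congr fun y hy => ?_
  have hF : HasFDerivWithinAt F (fderivWithin ℝ F S (x, y)) S (x, y) :=
    (hf.smooth.differentiableOn (by simp) _ (hmaps hy)).hasFDerivWithinAt
  have hline : HasDerivAt (fun t : ℝ => (x + t • (Pi.single l 1 : Space d), y))
      (Pi.single l 1, 0) 0 := by
    refine HasDerivAt.prodMk ?_ (hasDerivAt_const _ _)
    simpa using ((hasDerivAt_id (0 : ℝ)).smul_const (Pi.single l 1 : Space d)).const_add x
  exact (hF.comp_hasDerivAt_of_eq (x := (0 : ℝ)) hline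
    (Filter.Eventually.of_forall fun t => ⟨Set.mem_univ _, hy⟩) (by simp)).deriv

theorem IsMacroField.contDiffOn_derivWithin {f : Space d → ℝ → ℝ} (hf : IsMacroField f)
    (x : Space d) :
    ContDiffOn ℝ ∞ (derivWithin (fun y => f x y) (Set.Icc (0 : ℝ) 1)) (Set.Icc (0 : ℝ) 1) :=
  (hf.smooth.comp (contDiff_const.prodMk contDiff_id).contDiffOn
    fun _ hy => ⟨Set.mem_univ x, hy⟩).derivWithin (uniqueDiffOn_Icc zero_lt_one) (by simp)

/-- `X` enters only through the factors `∂_l H`, which pass through the `y`-derivatives; what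
remains is a combination of them with constant coefficients. -/
theorem continuous_taylorTerm (hH : ContDiff ℝ ∞ H) {s : Space d → ℝ → Tensor d}
    (hs : ∀ m n, IsMacroField fun x y => s x y m n) (q : ℕ) (x : Space d) (m n : Fin (d + 1)) :
    Continuous fun X => taylorTerm H q s x X m n := by
  have h0 : (0 : ℝ) ∈ Set.Icc (0 : ℝ) 1 := Set.left_mem_Icc.2 zero_le_one
  have hu : UniqueDiffOn ℝ (Set.Icc (0 : ℝ) 1) := uniqueDiffOn_Icc zero_lt_one
  have hq : (q : WithTop ℕ∞) ≤ ∞ := by exact_mod_cast le_top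
  have hc : ∀ l, ContDiffOn ℝ q (fun y => pd l (fun x' => s x' y m n) x) (Set.Icc (0 : ℝ) 1) :=
    fun l => ((hs m n).contDiffOn_pd l x).of_le hq
  have hsplit : ∀ X, taylorTerm H q s x X m n
      = ∑ l, pd l H X * iteratedDerivWithin q (fun y => pd l (fun x' => s x' y m n) x)
          (Set.Icc (0 : ℝ) 1) 0
        + iteratedDerivWithin q (derivWithin (fun y => s x y m n) (Set.Icc (0 : ℝ) 1))
          (Set.Icc (0 : ℝ) 1) 0 := by
    intro X
    simp only [taylorTerm, gradHMacro, Matrix.of_apply]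
    have hterm : ∀ l, ContDiffOn ℝ q (fun y => pd l H X * pd l (fun x' => s x' y m n) x)
        (Set.Icc (0 : ℝ) 1) := fun l => contDiffOn_const.mul (hc l)
    rw [iteratedDerivWithin_fun_add h0 hu (ContDiffWithinAt.sum fun l _ => hterm l 0 h0)
      ((((hs m n).contDiffOn_derivWithin x).of_le hq) 0 h0),
      iteratedDerivWithin_fun_sum h0 hu fun l _ => hterm l 0 h0]
    simp only [iteratedDerivWithin_const_mul_field]
  simp only [hsplit]
  exact (continuous_finsetSum _ fun l _ => (continuous_pd hH l).mul continuous_const).add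
    continuous_const

theorem continuous_gradHBdry (hH : ContDiff ℝ ∞ H) {S : Space d → Space d → ℝ → Tensor d}
    (hS : ∀ m n, IsMicroField H fun x X Y => S x X Y m n) (x : Space d) (m n : Fin (d + 1)) :
    Continuous fun X => gradHBdry H S x X m n := by
  set F : Space d × Space d → ℝ := fun q => S q.1 q.2 (-H q.2) m n
  -- The graph of `-H` lies in the closed domain, so the trace is smooth on the whole space; its
  -- `x`-derivatives keep the boundary point fixed.
  have hF : ContDiff ℝ ∞ F := contDiffOn_univ.1 <|
    (hS m n).smooth.comp (g := fun q : Space d × Space d × ℝ => S q.1 q.2.1 q.2.2 m n)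
      (f := fun q : Space d × Space d => (q.1, q.2, -H q.2))
      (contDiff_fst.prodMk (contDiff_snd.prodMk (hH.comp contDiff_snd).neg)).contDiffOn
      fun q _ => le_refl (-H q.2)
  have hpd : ∀ (l : Fin d) (X : Space d), pd l (fun x' => S x' X (-H X) m n) x
      = fderiv ℝ F (x, X) (Pi.single l 1, 0) := by
    intro l X
    have hline : HasDerivAt (fun t : ℝ => (x + t • (Pi.single l 1 : Space d), X))
        (Pi.single l 1, 0) 0 := by
      refine HasDerivAt.prodMk ?_ (hasDerivAt_const _ _)
      simpa using ((hasDerivAt_id (0 : ℝ)).smul_const (Pi.single l 1 : Space d)).const_add x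
    exact ((hF.differentiable (by simp) (x, X)).hasFDerivAt.comp_hasDerivAt_of_eq (0 : ℝ) hline
      (by simp)).deriv
  simp only [gradHBdry, Matrix.of_apply, hpd]
  exact continuous_finsetSum _ fun l _ => (continuous_pd hH l).mul
    (((hF.continuous_fderiv (by simp)).comp (by fun_prop)).clm_apply continuous_const)

theorem integrableOn_N (hH : ContDiff ℝ ∞ H) (E : Expansion d H) (k : ℕ) (x : Space d)
    (m n : Fin (d + 1)) : IntegrableOn (fun X => N E (k + 1) x X m n) (cell d) := by
  simp only [N, Matrix.add_apply, Matrix.sum_apply, Matrix.smul_apply, smul_eq_mul]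
  refine ((integrableOn_gradHMacro hH _ x 0 m n).add
    (continuous_gradHBdry hH (E.Sg_field k) x m n).integrableOn_cell).add
    (Continuous.integrableOn_cell ?_)
  exact continuous_finsetSum _ fun q _ => (continuous_const.mul (hH.continuous.pow q)).mul
    (continuous_taylorTerm hH (E.σ_field (k - q)) q x m n)

/-! ### Locality of the differential operators -/

section Macro

variable {x : Space d} {y : ℝ}

theorem gradMacro_congr {f g : Space d → ℝ → ℝ} (hy : y ∈ Set.Icc (0 : ℝ) 1)
    (h : ∀ x, ∀ y ∈ Set.Icc (0 : ℝ) 1, f x y = g x y) : gradMacro f x y = gradMacro g x y := by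
  have h₁ : (fun x' => f x' y) = fun x' => g x' y := funext fun x' => h x' y hy
  have h₂ : derivWithin (fun y' => f x y') (Set.Icc (0 : ℝ) 1) y
      = derivWithin (fun y' => g x y') (Set.Icc (0 : ℝ) 1) y :=
    derivWithin_congr (h x) (h x y hy)
  rw [gradMacro, gradMacro, h₁, h₂]

theorem jacMacro_congr {u v : Space d → ℝ → Vec d} (hy : y ∈ Set.Icc (0 : ℝ) 1)
    (h : ∀ x, ∀ y ∈ Set.Icc (0 : ℝ) 1, u x y = v x y) : jacMacro u x y = jacMacro v x y := by
  ext m n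
  exact congrFun (gradMacro_congr hy fun x y hy => congrFun (h x y hy) m) n

theorem advMacro_congr {w : Vec d} {s t : Space d → ℝ → Tensor d} (hy : y ∈ Set.Icc (0 : ℝ) 1)
    (h : ∀ x, ∀ y ∈ Set.Icc (0 : ℝ) 1, s x y = t x y) : advMacro w s x y = advMacro w t x y := by
  ext m n
  exact congrArg (w ⬝ᵥ ·)
    (gradMacro_congr hy fun x y hy => congrFun (congrFun (h x y hy) m) n)

theorem gradHMacro_congr {s t : Space d → ℝ → Tensor d} (hy : y ∈ Set.Icc (0 : ℝ) 1)
    (h : ∀ x, ∀ y ∈ Set.Icc (0 : ℝ) 1, s x y = t x y) (X : Space d) :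
    gradHMacro H s x y X = gradHMacro H t x y X := by
  ext m n
  simp only [gradHMacro, h _ y hy]

theorem taylorTerm_congr {s t : Space d → ℝ → Tensor d}
    (h : ∀ x, ∀ y ∈ Set.Icc (0 : ℝ) 1, s x y = t x y) (q : ℕ) (X : Space d) :
    taylorTerm H q s x X = taylorTerm H q t x X := by
  ext m n
  refine iteratedDerivWithin_congr (fun y hy => ?_) (Set.left_mem_Icc.2 zero_le_one)
  have hst : Set.EqOn (fun y' => s x y' m n) (fun y' => t x y' m n) (Set.Icc (0 : ℝ) 1) :=
    fun y' hy' => congrFun (congrFun (h x y' hy') m) n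
  rw [gradHMacro_congr hy h, derivWithin_congr hst (hst hy)]

end Macro

section Micro

variable {x X : Space d} {Y : ℝ}

/-- The strict inequality persists for `X'` near `X`. On the boundary itself a two-sided fast
derivative could see values outside the domain; slow derivatives never leave it. -/
theorem pd_fast_congr {f g : Space d → Space d → ℝ → ℝ} (hH : Continuous H) (hY : -H X < Y)
    (h : ∀ x X Y, -H X ≤ Y → f x X Y = g x X Y) (l : Fin d) :
    pd l (fun X' => f x X' Y) X = pd l (fun X' => g x X' Y) X := by
  refine Filter.EventuallyEq.lineDeriv_eq ?_
  filter_upwards [hH.neg.continuousAt.eventually_lt_const hY] with X' hX'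
  exact h x X' Y hX'.le

theorem gradFast_congr {f g : Space d → Space d → ℝ → ℝ} (hH : Continuous H) (hY : -H X < Y)
    (h : ∀ x X Y, -H X ≤ Y → f x X Y = g x X Y) : gradFast f x X Y = gradFast g x X Y := by
  have h₂ : deriv (fun Y' => f x X Y') Y = deriv (fun Y' => g x X Y') Y := by
    refine Filter.EventuallyEq.deriv_eq ?_
    filter_upwards [Ioi_mem_nhds hY] with Y' hY'
    exact h x X Y' (le_of_lt hY')
  simp only [gradFast, pd_fast_congr hH hY h, h₂]

theorem gradSlow_congr {f g : Space d → Space d → ℝ → ℝ} (hY : -H X ≤ Y)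
    (h : ∀ x X Y, -H X ≤ Y → f x X Y = g x X Y) : gradSlow f x X Y = gradSlow g x X Y := by
  simp only [gradSlow, h _ X Y hY]

theorem jacFast_congr {U V : Space d → Space d → ℝ → Vec d} (hH : Continuous H) (hY : -H X < Y)
    (h : ∀ x X Y, -H X ≤ Y → U x X Y = V x X Y) : jacFast U x X Y = jacFast V x X Y := by
  ext m n
  exact congrFun (gradFast_congr hH hY fun x X Y hY => congrFun (h x X Y hY) m) n

theorem jacSlow_congr {U V : Space d → Space d → ℝ → Vec d} (hY : -H X ≤ Y)
    (h : ∀ x X Y, -H X ≤ Y → U x X Y = V x X Y) : jacSlow U x X Y = jacSlow V x X Y := by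
  simp only [jacSlow, gradSlow, h _ X Y hY]

theorem advFast_congr {w : Vec d} {S T : Space d → Space d → ℝ → Tensor d} (hH : Continuous H)
    (hY : -H X < Y) (h : ∀ x X Y, -H X ≤ Y → S x X Y = T x X Y) :
    advFast w S x X Y = advFast w T x X Y := by
  ext m n
  exact congrArg (w ⬝ᵥ ·)
    (gradFast_congr hH hY fun x X Y hY => congrFun (congrFun (h x X Y hY) m) n)

theorem advSlow_congr {w : Vec d} {S T : Space d → Space d → ℝ → Tensor d} (hY : -H X ≤ Y)
    (h : ∀ x X Y, -H X ≤ Y → S x X Y = T x X Y) : advSlow w S x X Y = advSlow w T x X Y := by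
  simp only [advSlow, gradSlow, h _ X Y hY]

theorem mixedLaplacian_congr {S T : Space d → Space d → ℝ → Tensor d} (hH : Continuous H)
    (hY : -H X < Y) (h : ∀ x X Y, -H X ≤ Y → S x X Y = T x X Y) :
    mixedLaplacian S x X Y = mixedLaplacian T x X Y := by
  ext m n
  simp only [mixedLaplacian, Matrix.of_apply]
  refine Finset.sum_congr rfl fun l _ => ?_
  congr 1
  -- The inner fast derivatives agree at every slow point, so the outer derivative acts on one and
  -- the same function.
  funext x'
  exact pd_fast_congr (f := fun x X Y => S x X Y m n) (g := fun x X Y => T x X Y m n) hH hY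
    (fun x X Y hY => congrFun (congrFun (h x X Y hY) m) n) l

theorem slowLaplacian_congr {S T : Space d → Space d → ℝ → Tensor d} (hY : -H X ≤ Y)
    (h : ∀ x X Y, -H X ≤ Y → S x X Y = T x X Y) :
    slowLaplacian S x X Y = slowLaplacian T x X Y := by
  simp only [slowLaplacian, h _ X Y hY]

theorem gradHBdry_congr {S T : Space d → Space d → ℝ → Tensor d}
    (h : ∀ x X Y, -H X ≤ Y → S x X Y = T x X Y) : gradHBdry H S x X = gradHBdry H T x X := by
  simp only [gradHBdry, h _ X _ le_rfl]

end Micro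

/-! ### Dependence of the source terms on the expansion -/

section Dependence

variable {E E' : Expansion d H} {k : ℕ}

theorem G_congr (We r a D : ℝ) (hH : Continuous H) (hmac : ∀ j < k, SameMacro E E' j)
    (hmic : ∀ j ≤ k, SameMicro E E' j) {x X : Space d} {y Y : ℝ} (hy : y ∈ Set.Icc (0 : ℝ) 1)
    (hY : -H X < Y) : G We r a D E (k + 1) x y X Y = G We r a D E' (k + 1) x y X Y := by
  obtain _ | k := k
  · rfl
  have hu : ∀ j ≤ k, ∀ x, ∀ y ∈ Set.Icc (0 : ℝ) 1, E.u j x y = E'.u j x y :=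
    fun j hj x y hy => (hmac j (Nat.lt_succ_of_le hj) x y hy).1
  have hs : ∀ j ≤ k, ∀ x, ∀ y ∈ Set.Icc (0 : ℝ) 1, E.σ j x y = E'.σ j x y :=
    fun j hj x y hy => (hmac j (Nat.lt_succ_of_le hj) x y hy).2.2
  have hU : ∀ j ≤ k + 1, ∀ x X Y, -H X ≤ Y → E.U j x X Y = E'.U j x X Y :=
    fun j hj x X Y hY => (hmic j hj x X Y hY).1
  have hS : ∀ j ≤ k + 1, ∀ x X Y, -H X ≤ Y → E.Sg j x X Y = E'.Sg j x X Y :=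
    fun j hj x X Y hY => (hmic j hj x X Y hY).2.2
  simp only [G]
  rw [jacFast_congr hH hY (hU (k + 1) le_rfl), jacSlow_congr hY.le (hU k (by omega)),
    hS k (by omega) x X Y hY.le, mixedLaplacian_congr hH hY (hS (k + 1) le_rfl),
    slowLaplacian_congr hY.le (hS k (by omega))]
  congr 2
  refine Finset.sum_congr rfl fun i hi => ?_
  have hik : i ≤ k := Nat.lt_succ_iff.1 (Finset.mem_range.1 hi)
  rw [hu i hik x y hy, jacMacro_congr hy (hu i hik), hs (k - i) (by omega) x y hy,
    advMacro_congr hy (hs (k - i) (by omega)), hU i (by omega) x X Y hY.le,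
    jacFast_congr hH hY (hU (i + 1) (by omega)), jacSlow_congr hY.le (hU i (by omega)),
    -- The advection rewrites come in pairs, one for transport by `u i` and one for transport by `U
    -- i`.
    hS (k - i) (by omega) x X Y hY.le, advFast_congr hH hY (hS (k + 1 - i) (by omega)),
    advFast_congr hH hY (hS (k + 1 - i) (by omega)),
    advSlow_congr hY.le (hS (k - i) (by omega)), advSlow_congr hY.le (hS (k - i) (by omega))]

theorem N_sub_gradHMacro_congr (hmac : ∀ j < k, SameMacro E E' j)
    (hmic : ∀ j ≤ k, SameMicro E E' j) (x X : Space d) :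
    N E (k + 1) x X - gradHMacro H (E.σ k) x 0 X
      = N E' (k + 1) x X - gradHMacro H (E'.σ k) x 0 X := by
  simp only [N, add_assoc, add_sub_cancel_left]
  rw [gradHBdry_congr fun x X Y hY => (hmic k le_rfl x X Y hY).2.2]
  congr 1
  refine Finset.sum_congr rfl fun q hq => ?_
  have hq := Finset.mem_Icc.1 hq
  -- The sum starts at `q = 1`, hence `k - q < k`.
  rw [taylorTerm_congr fun x y hy => (hmac (k - q) (by omega) x y hy).2.2]

/-- The integrands may differ pointwise, since `σ k` is unconstrained, but only by a difference of
two terms of zero mean. -/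
theorem integral_N_congr (hH : IsProfile H) (hmac : ∀ j < k, SameMacro E E' j)
    (hmic : ∀ j ≤ k, SameMicro E E' j) (x : Space d) (m n : Fin (d + 1)) :
    ∫ X in cell d, N E (k + 1) x X m n = ∫ X in cell d, N E' (k + 1) x X m n := by
  have hdecomp : ∀ X, N E (k + 1) x X m n = N E' (k + 1) x X m n
      + (gradHMacro H (E.σ k) x 0 X m n - gradHMacro H (E'.σ k) x 0 X m n) := by
    intro X
    have h := congrFun (congrFun (N_sub_gradHMacro_congr hmac hmic x X) m) n
    simp only [Matrix.sub_apply] at h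
    linarith
  have hi := integrableOn_gradHMacro hH.smooth (E.σ k) x 0 m n
  have hi' := integrableOn_gradHMacro hH.smooth (E'.σ k) x 0 m n
  have hsub : IntegrableOn (fun X => gradHMacro H (E.σ k) x 0 X m n
      - gradHMacro H (E'.σ k) x 0 X m n) (cell d) := hi.sub hi'
  have hzero : ∫ X in cell d, (gradHMacro H (E.σ k) x 0 X m n
      - gradHMacro H (E'.σ k) x 0 X m n) = 0 := by
    rw [integral_sub hi hi', integral_gradHMacro hH, integral_gradHMacro hH, sub_zero]
  simp only [hdecomp]
  rw [integral_add (integrableOn_N hH.smooth E' k x m n) hsub, hzero, add_zero]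

theorem measurableSet_roughCell (hH : Continuous H) : MeasurableSet (roughCell H) :=
  (measurable_fst measurableSet_cell).inter
    ((measurableSet_lt (hH.comp continuous_fst).neg.measurable measurable_snd).inter
      (measurableSet_lt measurable_snd measurable_const))

theorem b_congr (We r a D : ℝ) (hH : IsProfile H) (hmac : ∀ j < k, SameMacro E E' j)
    (hmic : ∀ j ≤ k, SameMicro E E' j) (x : Space d) {y : ℝ} (hy : y ∈ Set.Icc (0 : ℝ) 1) :
    b We r a D E k x y = b We r a D E' k x y := by
  ext m n
  simp only [b, Matrix.of_apply]
  -- The sources agree at each point of `roughCell`, which excludes the rough boundary, so no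
  -- integrability of `G` is needed.
  rw [integral_N_congr hH hmac hmic, setIntegral_congr_fun
    (measurableSet_roughCell hH.smooth.continuous) fun q hq => ?_]
  exact congrFun (congrFun (G_congr We r a D hH.smooth.continuous hmac hmic hy hq.2.1) m) n

end Dependence

end RoughOldroyd

theorem proposition7 {d : ℕ} (We r a D : ℝ) (hD : 0 < D)
    (H : RoughOldroyd.Space d → ℝ) (hH : RoughOldroyd.IsProfile H) (k : ℕ) :
    -- `(∇H·∇_x)σ_k|_{y=0}`, the term of `N_{k+1}` that involves `σ_k`, has zero `X`-average
    (∀ (E : RoughOldroyd.Expansion d H) (x : RoughOldroyd.Space d) (m n : Fin (d + 1)),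
      MeasureTheory.IntegrableOn (fun X => RoughOldroyd.gradHMacro H (E.σ k) x 0 X m n)
        (RoughOldroyd.cell d) ∧
      ∫ X in RoughOldroyd.cell d, RoughOldroyd.gradHMacro H (E.σ k) x 0 X m n = 0) ∧
    -- everything else, and `b_k` itself, depends only on the terms of index `j < k`, resp. `j ≤ k`
    (∀ E E' : RoughOldroyd.Expansion d H,
      (∀ j < k, RoughOldroyd.SameMacro E E' j) → (∀ j ≤ k, RoughOldroyd.SameMicro E E' j) →
      (∀ x, ∀ y ∈ Set.Icc (0 : ℝ) 1, ∀ X Y, -H X < Y →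
        RoughOldroyd.G We r a D E (k + 1) x y X Y = RoughOldroyd.G We r a D E' (k + 1) x y X Y) ∧
      (∀ x X,
        RoughOldroyd.N E (k + 1) x X - RoughOldroyd.gradHMacro H (E.σ k) x 0 X
          = RoughOldroyd.N E' (k + 1) x X - RoughOldroyd.gradHMacro H (E'.σ k) x 0 X) ∧
      (∀ x, ∀ y ∈ Set.Icc (0 : ℝ) 1,
        RoughOldroyd.b We r a D E k x y = RoughOldroyd.b We r a D E' k x y)) := by
  exact ⟨fun E x m n =>
      ⟨RoughOldroyd.integrableOn_gradHMacro hH.smooth (E.σ k) x 0 m n,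
        RoughOldroyd.integral_gradHMacro hH (E.σ k) x 0 m n⟩,
    fun E E' hmac hmic =>
      ⟨fun x y hy X Y hY =>
          RoughOldroyd.G_congr We r a D hH.smooth.continuous hmac hmic hy hY,
        RoughOldroyd.N_sub_gradHMacro_congr hmac hmic,
        fun x y hy => RoughOldroyd.b_congr We r a D hH hmac hmic x hy⟩⟩
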